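/- Let $s\in(0,1)$, $N>2s$, and let $\Omega\subset\mathbb{R}^N$ be a nonempty bounded open set (for instance a smooth bounded domain). Let $$X_0^s(\Omega)=\Big\{u\in L^2(\mathbb{R}^N): u=0 \text{ a.e. in } \mathbb{R}^N\setminus\Omega,\ \int_{\mathbb{R}^{2N}}\frac{|u(x)-u(y)|^2}{|x-y|^{N+2s}}\,dx\,dy<\infty\Big\},$$ and for $u,v\in X_0^s(\Omega)$ put $$\langle(-\Delta)^su,v\rangle=\int_{\mathbb{R}^{2N}}\frac{(u(x)-u(y))(v(x)-v(y))}{|x-y|^{N+2s}}\,dx\,dy .$$ For $u\in X_0^s(\Omega)$ and a function $f$ on $\Omega$, write $(-\Delta)^su=f$ if $\langle(-\Delta)^su,v\rangle=\int_\Omega fv\,dx$ for all $v\in X_0^s(\Omega)$. Let $\mathcal{T}_s(\Omega)=\{\psi\in X_0^s(\Omega):(-\Delta)^s\psi\in C_c^\infty(\Omega)\}$. For $u\in L^1(\Omega)$ and $f\in L^2(\Omega)$, say that $(-\Delta)^su=f$ in the $L^1$-weak sense if $\int_\Omega u\,(-\Delta)^s\psi\,dx=\int_\Omega f\psi\,dx$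 for all $\psi\in\mathcal{T}_s(\Omega)$, and let $$\mathcal{H}^{2s}(\Omega)=\mathcal{W}^{2s,2}(\Omega)=\{u\in L^1(\Omega):\ \exists f\in L^2(\Omega)\text{ with } (-\Delta)^su=f\text{ in the }L^1\text{-weak sense}\}.$$ There exists an orthonormal basis $(\varphi_j)_{j\ge1}$ of the real space $L^2(\Omega)$ consisting of Dirichlet eigenfunctions of $(-\Delta)^s$, with eigenvalues $\lambda_1\le\lambda_2\le\cdots$; that is, $\varphi_j$, extended by $0$, belongs to $X_0^s(\Omega)$ and $(-\Delta)^s\varphi_j=\lambda_j\varphi_j$. Moreover, for every orthonormal basis $(\varphi_j)_{j\ge 1}$ of $L^2(\Omega)$ of such eigenfunctions, with eigenvalues $(\lambda_j)_{j\ge 1}$ enumerated in any order, let $$E^{2s}=\Big\{u=\sum_{j\ge1}a_j\varphi_j\in L^2(\Omega):\ \sum_{j\ge1}\lambda_j^2a_j^2<\infty\Big\},\qquad A^{2s}u=\sum_{j\ge1}\lambda_ja_j\varphi_j .$$ Then $E^{2s}=\mathcal{H}^{2s}(\Omega)$, and for every $u\in E^{2s}$ the series $A^{2s}u$ converges in $L^2(\Omega)$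 and $A^{2s}u=(-\Delta)^su$: that is, $A^{2s}u$ is the unique $f\in L^2(\Omega)$ such that $(-\Delta)^su=f$ in the $L^1$-weak sense. -/

import Mathlib

open MeasureTheory
open scoped ContDiff ENNReal

noncomputable section

namespace FracLap

/-- Euclidean space `ℝ^N`. -/
abbrev RN (N : ℕ) : Type := EuclideanSpace ℝ (Fin N)

/-- Lebesgue measure on `Ω`. -/
abbrev volOn {N : ℕ} (Ω : Set (RN N)) : Measure (RN N) := volume.restrict Ω

/-- The integrand `(u(x) - u(y)) (v(x) - v(y)) / |x - y|^(N + 2s)` on `ℝ^N × ℝ^N`. -/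
def kernelFun {N : ℕ} (s : ℝ) (u v : RN N → ℝ) (z : RN N × RN N) : ℝ :=
  (u z.1 - u z.2) * (v z.1 - v z.2) / ‖z.1 - z.2‖ ^ ((N : ℝ) + 2 * s)

/-- `u ∈ X_0^s(Ω)`: `u ∈ L²(ℝ^N)`, `u = 0` a.e. outside `Ω`, and
`∫∫ |u(x) - u(y)|² / |x - y|^(N + 2s) dx dy < ∞`. -/
structure MemX0 {N : ℕ} (s : ℝ) (Ω : Set (RN N)) (u : RN N → ℝ) : Prop where
  memLp : MemLp u 2 volume
  ae_eq_zero : ∀ᵐ x : RN N, x ∉ Ω → u x = 0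
  integrable : Integrable (kernelFun s u u) volume

/-- The duality bracket `⟨(-Δ)^s u, v⟩` on `X_0^s(Ω)`, that is
`∫∫ (u(x) - u(y)) (v(x) - v(y)) / |x - y|^(N + 2s) dx dy`. -/
def pairing {N : ℕ} (s : ℝ) (u v : RN N → ℝ) : ℝ :=
  ∫ z : RN N × RN N, kernelFun s u v z

/-- `u ∈ X_0^s(Ω)` and the functional `(-Δ)^s u` on `X_0^s(Ω)` is the function `f`:
`⟨(-Δ)^s u, v⟩ = ∫_Ω f v` for all `v ∈ X_0^s(Ω)`. -/
def HasFracLap {N : ℕ} (s : ℝ) (Ω : Set (RN N)) (u f : RN N → ℝ) : Prop :=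
  MemX0 s Ω u ∧ ∀ v : RN N → ℝ, MemX0 s Ω v → pairing s u v = ∫ x in Ω, f x * v x

/-- `g ∈ C_c^∞(Ω)`. -/
def IsTestFun {N : ℕ} (Ω : Set (RN N)) (g : RN N → ℝ) : Prop :=
  ContDiff ℝ ∞ g ∧ HasCompactSupport g ∧ tsupport g ⊆ Ω

/-- `(-Δ)^s u = f` in the `L¹`-weak sense: `∫_Ω u (-Δ)^s ψ = ∫_Ω f ψ` for every `ψ` in
`𝒯_s(Ω) = {ψ ∈ X_0^s(Ω) : (-Δ)^s ψ ∈ C_c^∞(Ω)}`; here `g` stands for `(-Δ)^s ψ`. -/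
def L1WeakEq {N : ℕ} (s : ℝ) (Ω : Set (RN N)) (u f : RN N →ₘ[volOn Ω] ℝ) : Prop :=
  ∀ ψ g : RN N → ℝ, IsTestFun Ω g → HasFracLap s Ω ψ g →
    ∫ x in Ω, u x * g x = ∫ x in Ω, f x * ψ x

/-- `𝒲^{2s,r}(Ω)`: the `u ∈ L¹(Ω)` for which some `f ∈ L^r(Ω)` satisfies `(-Δ)^s u = f`
in the `L¹`-weak sense. -/
def WSpace {N : ℕ} (s : ℝ) (r : ℝ≥0∞) (Ω : Set (RN N)) : Set (RN N →ₘ[volOn Ω] ℝ) :=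
  {u | u ∈ Lp ℝ 1 (volOn Ω) ∧ ∃ f ∈ Lp ℝ r (volOn Ω), L1WeakEq s Ω u f}

/-- `ℋ^{2s}(Ω) = 𝒲^{2s,2}(Ω)`. -/
def HSpace {N : ℕ} (s : ℝ) (Ω : Set (RN N)) : Set (RN N →ₘ[volOn Ω] ℝ) :=
  WSpace s 2 Ω

/-- The orthonormal basis `φ_j` of `L²(Ω)` consists of Dirichlet eigenfunctions of `(-Δ)^s`
with eigenvalues `λ_j`: the extension of `φ_j` by zero lies in `X_0^s(Ω)` and
`⟨(-Δ)^s φ_j, v⟩ = ∫_Ω λ_j φ_j v` for all `v ∈ X_0^s(Ω)`. -/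
def IsEigenbasis {N : ℕ} (s : ℝ) (Ω : Set (RN N)) (lam : ℕ → ℝ)
    (φ : HilbertBasis ℕ ℝ (Lp ℝ 2 (volOn Ω))) : Prop :=
  ∀ j : ℕ, HasFracLap s Ω (Ω.indicator (φ j)) (fun x => lam j * φ j x)

/-- `E^α`: the `u = ∑ a_j φ_j ∈ L²(Ω)` with `∑ λ_j^(α/s) a_j² < ∞`. -/
def ESpace {N : ℕ} {Ω : Set (RN N)} (s α : ℝ) (lam : ℕ → ℝ)
    (φ : HilbertBasis ℕ ℝ (Lp ℝ 2 (volOn Ω))) : Set (RN N →ₘ[volOn Ω] ℝ) :=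
  {u | ∃ h : u ∈ Lp ℝ 2 (volOn Ω), Summable fun j => lam j ^ (α / s) * (φ.repr ⟨u, h⟩ j) ^ 2}

/-- The `j`-th term `λ_j^(α/(2s)) a_j φ_j` of the series defining `A^α u`. -/
def powerTerm {N : ℕ} {Ω : Set (RN N)} (s α : ℝ) (lam : ℕ → ℝ)
    (φ : HilbertBasis ℕ ℝ (Lp ℝ 2 (volOn Ω))) (u : Lp ℝ 2 (volOn Ω)) (j : ℕ) :
    Lp ℝ 2 (volOn Ω) :=
  (lam j ^ (α / (2 * s)) * φ.repr u j) • φ j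

/-- `A^α u = ∑ λ_j^(α/(2s)) a_j φ_j`, the series being taken in `L²(Ω)`. -/
def APower {N : ℕ} {Ω : Set (RN N)} (s α : ℝ) (lam : ℕ → ℝ)
    (φ : HilbertBasis ℕ ℝ (Lp ℝ 2 (volOn Ω))) (u : Lp ℝ 2 (volOn Ω)) : Lp ℝ 2 (volOn Ω) :=
  ∑' j, powerTerm s α lam φ u j

end FracLap

end

/-! Everything rests on the solution operator `S` of the Dirichlet problem: `S f` is the function of
X_0^s(Ω) whose fractional Laplacian is `f ∈ L²(Ω)`. Both spaces equal the range of `S`.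

Let `D` send `u` to the quotient (u(x) - u(y)) / |x - y|^((N + 2s)/2), so that the bracket is ⟨Du,
Dv⟩. `D` is closed, densely defined, and bounded below by a Poincaré inequality, so `S` = (D*D)⁻¹ =
D⁻¹(D⁻¹)* is bounded, symmetric and positive. It is compact because bounded sets of X_0^s(Ω) are
uniformly close to step functions on small cubes. The spectral theorem for `S` gives the eigenbasis,
with eigenvalues 1/μ.

In any eigenbasis `S` divides the j-th coefficient by λ_j, so its range is E^{2s} and A^{2s} inverts
it (`mem_ESpace_iff`, `hasSum_powerTerm`). On the other side, the admissible ψ are the `S g` with g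
∈ C_c^∞(Ω), and ∫ f S g = ∫ (S f) g. Hence (-Δ)^s u = f holds L¹-weakly iff u - S f annihilates
C_c^∞(Ω), that is, iff u = S f (`l1WeakEq_iff_eq_solution`). No boundary regularity enters. -/

namespace FracLap

open Filter Topology

/-! ### Spectral theorem with ordered eigenvalues -/

/-- An infinite type carrying a positive function all of whose superlevel sets `{i | ε ≤ f i}`
are finite can be enumerated by `ℕ` so that the function is antitone. -/
theorem exists_equiv_nat_antitone {ι : Type*} [Infinite ι] (f : ι → ℝ) (hpos : ∀ i, 0 < f i)
    (hfin : ∀ ε > 0, {i | ε ≤ f i}.Finite) : ∃ e : ℕ ≃ ι, Antitone (f ∘ e) := by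
  classical
  have hc : Countable ι := by
    have h : (⋃ n : ℕ, {i | 1 / ((n : ℝ) + 1) ≤ f i}) = Set.univ := by
      refine Set.eq_univ_of_forall fun i => ?_
      obtain ⟨n, hn⟩ := exists_nat_one_div_lt (hpos i)
      exact Set.mem_iUnion.2 ⟨n, hn.le⟩
    rw [← Set.countable_univ_iff, ← h]
    exact Set.countable_iUnion fun n => (hfin _ (by positivity)).countable
  obtain ⟨enc, henc⟩ := exists_injective_nat ι
  -- Order by decreasing `f`, ties broken by an injection into `ℕ`. Initial segments are then
  -- finite, so the order type is that of `ℕ`.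
  let key : ι → ℝ ×ₗ ℕ := fun i => toLex (-f i, enc i)
  have hkey : Function.Injective key := fun i j h => henc (Prod.ext_iff.1 (toLex.injective h)).2
  let _ : LinearOrder ι := LinearOrder.lift' key hkey
  have hle : ∀ i j : ι, i ≤ j → f j ≤ f i := by
    intro i j h
    have h' : key i ≤ key j := h
    rcases (Prod.Lex.toLex_le_toLex).1 h' with h1 | h1
    · simp only at h1; linarith
    · simp only at h1; linarith [h1.1]
  have hIic : ∀ i : ι, (Set.Iic i).Finite := fun i =>
    (hfin _ (hpos i)).subset fun j hj => hle j i hj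
  let _ : LocallyFiniteOrder ι := LocallyFiniteOrder.ofFiniteIcc fun a b =>
    (hIic b).subset Set.Icc_subset_Iic_self
  have : NoMaxOrder ι := by
    refine ⟨fun a => ?_⟩
    obtain ⟨b, hb⟩ := (hIic a).infinite_compl.nonempty
    exact ⟨b, not_le.1 hb⟩
  obtain ⟨m, hm⟩ : ∃ m : ι, ∀ a, m ≤ a := by
    obtain ⟨a⟩ := (inferInstance : Nonempty ι)
    obtain ⟨m, hm1, hm2⟩ := Set.exists_min_image (Set.Iic a) id (hIic a) ⟨a, Set.mem_Iic.2 le_rfl⟩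
    refine ⟨m, fun b => ?_⟩
    rcases le_total b a with h | h
    · exact hm2 b h
    · exact (hm2 a (Set.mem_Iic.2 le_rfl)).trans h
  let _ : OrderBot ι := { bot := m, bot_le := hm }
  let _ : SuccOrder ι := LinearLocallyFiniteOrder.succOrder ι
  let _ : PredOrder ι := LinearLocallyFiniteOrder.predOrder ι
  let e : ι ≃o ℕ := orderIsoNatOfLinearSuccPredArch
  exact ⟨e.symm.toEquiv, fun a b h => hle _ _ (e.symm.monotone h)⟩

/-- An orthonormal family of eigenvectors of a compact operator has only finitely many members
with eigenvalue at least `ε`. -/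
theorem finite_setOf_le_eigenvalue {H : Type*} [NormedAddCommGroup H] [InnerProductSpace ℝ H]
    {T : H →L[ℝ] H} (hT : IsCompactOperator T) {ι : Type*} {v : ι → H} (hv : Orthonormal ℝ v)
    {μ : ι → ℝ} (hμ : ∀ i, T (v i) = μ i • v i) {ε : ℝ} (hε : 0 < ε) :
    {i | ε ≤ μ i}.Finite := by
  by_contra hinf
  have hinf : {i | ε ≤ μ i}.Infinite := hinf
  let a := hinf.natEmbedding
  obtain ⟨K, hK, hsub⟩ := hT.image_closedBall_subset_compact (f := (T : H →ₗ[ℝ] H)) 1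
  obtain ⟨x, -, n, hn, hlim⟩ := hK.tendsto_subseq (x := fun k => T (v (a k))) fun k =>
    hsub ⟨v (a k), by simp [hv.1], rfl⟩
  have hcau := hlim.cauchySeq
  rw [Metric.cauchySeq_iff'] at hcau
  obtain ⟨k, hk⟩ := hcau ε hε
  have h1 := hk (k + 1) (by omega)
  have hne : (a (n (k + 1)) : ι) ≠ a (n k) := fun h =>
    absurd (hn.injective (a.injective (Subtype.ext h))) (by omega)
  -- Images of distinct eigenvectors are orthogonal, so they stay at distance at least ε, which no
  -- convergent subsequence allows.
  have hsq : ‖T (v (a (n (k + 1)))) - T (v (a (n k)))‖ ^ 2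
      = μ (a (n (k + 1))) ^ 2 + μ (a (n k)) ^ 2 := by
    rw [@norm_sub_sq_real, hμ, hμ, norm_smul, norm_smul, hv.1, hv.1, inner_smul_left,
      inner_smul_right, hv.2 hne]
    simp
  have h2 : ε ≤ μ (a (n (k + 1))) := (a (n (k + 1))).2
  simp only [Function.comp_apply, dist_eq_norm] at h1
  have h3 : ‖T (v (a (n (k + 1)))) - T (v (a (n k)))‖ ^ 2 < ε ^ 2 := by gcongr
  nlinarith [sq_nonneg (μ (a (n k)))]

/-- Spectral theorem for an injective positive compact self-adjoint operator on an
infinite-dimensional real Hilbert space, with the eigenvalues in decreasing order. -/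
theorem exists_hilbertBasis_antitone_eigenvalues {H : Type*} [NormedAddCommGroup H]
    [InnerProductSpace ℝ H] [CompleteSpace H] (hdim : ¬ FiniteDimensional ℝ H) {T : H →L[ℝ] H}
    (hT : IsCompactOperator T) (hsym : (T : H →ₗ[ℝ] H).IsSymmetric)
    (hpos : ∀ x, x ≠ 0 → 0 < inner ℝ (T x) x) :
    ∃ (b : HilbertBasis ℕ ℝ H) (μ : ℕ → ℝ),
      Antitone μ ∧ (∀ j, 0 < μ j) ∧ ∀ j, T (b j) = μ j • b j := by
  classical
  let V : ℝ → Submodule ℝ H := fun μ => Module.End.eigenspace (T : H →ₗ[ℝ] H) μ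
  have hV0 : V 0 = ⊥ := by
    rw [Submodule.eq_bot_iff]
    intro x hx
    have hx' : T x = 0 := by simpa [V, Module.End.mem_eigenspace_iff] using hx
    by_contra hne
    simpa [hx'] using hpos x hne
  have hfd : ∀ μ, FiniteDimensional ℝ (V μ) := by
    intro μ
    by_cases hμ : μ = 0
    · rw [hμ, hV0]; infer_instance
    · exact ContinuousLinearMap.finite_dimensional_eigenspace hT μ hμ
  let w : ∀ μ, Fin (Module.finrank ℝ (V μ)) → V μ := fun μ => stdOrthonormalBasis ℝ (V μ)
  -- The sum runs over all real `μ`; the fibre is empty unless `μ` is an eigenvalue.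
  let ι := Σ μ, Fin (Module.finrank ℝ (V μ))
  let v : ι → H := fun i => w i.1 i.2
  have hfam : OrthogonalFamily ℝ (fun μ => V μ) fun μ => (V μ).subtypeₗᵢ :=
    hsym.orthogonalFamily_eigenspaces
  have hv : Orthonormal ℝ v :=
    hfam.orthonormal_sigma_orthonormal fun μ => (stdOrthonormalBasis ℝ (V μ)).orthonormal
  have heig : ∀ i, T (v i) = i.1 • v i := fun i =>
    Module.End.mem_eigenspace_iff.1 (w i.1 i.2).2
  have hμpos : ∀ i : ι, 0 < i.1 := by
    intro i
    have h := hpos (v i) (hv.ne_zero i)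
    rw [heig, inner_smul_left, real_inner_self_eq_norm_sq, hv.1] at h
    simpa using h
  have hspan : (Submodule.span ℝ (Set.range v))ᗮ = ⊥ := by
    rw [eq_bot_iff, ← ContinuousLinearMap.orthogonalComplement_iSup_eigenspaces_eq_bot hT hsym]
    refine Submodule.orthogonal_le (iSup_le fun μ => ?_)
    intro x hx
    have h1 := (stdOrthonormalBasis ℝ (V μ)).sum_repr ⟨x, hx⟩
    have h2 := congrArg (V μ).subtype h1
    rw [map_sum] at h2
    simp only [map_smul, Submodule.subtype_apply] at h2
    rw [← h2]
    exact Submodule.sum_mem _ fun k _ => Submodule.smul_mem _ _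
      (Submodule.subset_span ⟨⟨μ, k⟩, rfl⟩)
  let B := HilbertBasis.mkOfOrthogonalEqBot hv hspan
  have hB : ⇑B = v := HilbertBasis.coe_mkOfOrthogonalEqBot hv hspan
  have : Infinite ι := by
    by_contra hfin
    have : Finite ι := not_infinite_iff_finite.1 hfin
    apply hdim
    have h1 : (Submodule.span ℝ (Set.range v)) = ⊤ := by
      have : FiniteDimensional ℝ (Submodule.span ℝ (Set.range v)) :=
        FiniteDimensional.span_of_finite ℝ (Set.finite_range v)
      exact Submodule.orthogonal_eq_bot_iff.1 hspan
    exact Module.finite_def.2 ⟨(Set.finite_range v).toFinset, by simpa using h1⟩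
  obtain ⟨e, he⟩ := exists_equiv_nat_antitone (fun i : ι => i.1) hμpos fun ε hε =>
    finite_setOf_le_eigenvalue hT hv heig hε
  have hspan' : (Submodule.span ℝ (Set.range (v ∘ e)))ᗮ = ⊥ := by
    rw [e.surjective.range_comp]; exact hspan
  refine ⟨HilbertBasis.mkOfOrthogonalEqBot (hv.comp e e.injective) hspan', fun j => (e j).1, he,
    fun j => hμpos _, fun j => ?_⟩
  rw [HilbertBasis.coe_mkOfOrthogonalEqBot]
  exact heig _

/-! ### Inverting D*D for a closed operator D -/

section Abstract

variable {H K : Type*} [NormedAddCommGroup H] [InnerProductSpace ℝ H]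
  [NormedAddCommGroup K] [InnerProductSpace ℝ K]

/-- If `G ⊆ H × K` is the graph of a closed operator `D` that is bounded below, then `D* D` has a
bounded inverse `S` on `H`: for every `h` there is `W = D (S h)` with `⟪W, D q⟫ = ⟪h, q⟫` for all
`q` in the domain. -/
theorem exists_solution_operator [CompleteSpace H] [CompleteSpace K]
    {G : Submodule ℝ (H × K)} (hG : IsClosed (G : Set (H × K)))
    {C : ℝ} (hC : ∀ p ∈ G, ‖p.1‖ ≤ C * ‖p.2‖) :
    ∃ S : H →L[ℝ] H, ∀ h : H, ∃ W : K, (S h, W) ∈ G ∧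
      ∀ q ∈ G, inner ℝ W q.2 = inner ℝ h q.1 := by
  have : CompleteSpace G := hG.completeSpace_coe
  let f : G →L[ℝ] K := (ContinuousLinearMap.snd ℝ H K).comp G.subtypeL
  -- The product carries the sup norm, so the graph norm of a pair is controlled by its second entry
  -- with constant max(C, 1).
  have hf : AntilipschitzWith (max C 1).toNNReal f := by
    refine f.antilipschitz_of_bound fun p => ?_
    rw [Real.coe_toNNReal _ (by positivity)]
    refine max_le ?_ ?_
    · exact (hC p p.2).trans (mul_le_mul_of_nonneg_right (le_max_left _ _) (norm_nonneg _))
    · exact le_mul_of_one_le_left (norm_nonneg _) (le_max_right _ _)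
  have hclosed : IsClosed (Set.range f) := hf.isClosed_range f.uniformContinuous
  let e := f.equivRange hf.injective hclosed
  have : CompleteSpace f.range := hclosed.completeSpace_coe
  -- `ι` is D⁻¹ on the closed range of D. Then S = ι ι* and W = ι* h, since ⟨ι* h, Dq⟩ = ⟨h, ι D q⟩
  -- = ⟨h, q⟩.
  let ι : f.range →L[ℝ] H :=
    ((ContinuousLinearMap.fst ℝ H K).comp G.subtypeL).comp (e.symm : f.range →L[ℝ] G)
  refine ⟨ι.comp ι.adjoint, fun h => ⟨(ι.adjoint h : f.range), ?_, fun q hq => ?_⟩⟩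
  · have h1 : f (e.symm (ι.adjoint h)) = ι.adjoint h :=
      congrArg Subtype.val (e.apply_symm_apply (ι.adjoint h))
    have h2 : ((ι.comp ι.adjoint) h, ((ι.adjoint h : f.range) : K)) =
        (e.symm (ι.adjoint h) : H × K) := Prod.ext rfl h1.symm
    rw [h2]
    exact (e.symm (ι.adjoint h)).2
  · have h1 : ι (e ⟨q, hq⟩) = q.1 := by
      simp only [ι, ContinuousLinearMap.comp_apply, ContinuousLinearEquiv.coe_coe,
        ContinuousLinearEquiv.symm_apply_apply]
      rfl
    rw [← h1, ← ContinuousLinearMap.adjoint_inner_left]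
    rfl

variable {G : Submodule ℝ (H × K)} {S : H →L[ℝ] H}

theorem isSymmetric_solution_operator (hS : ∀ h : H, ∃ W : K, (S h, W) ∈ G ∧
    ∀ q ∈ G, inner ℝ W q.2 = inner ℝ h q.1) : (S : H →ₗ[ℝ] H).IsSymmetric := by
  intro h k
  obtain ⟨W, hW, hWq⟩ := hS h
  obtain ⟨Z, hZ, hZq⟩ := hS k
  have h1 := hWq _ hZ
  have h2 := hZq _ hW
  simp only [ContinuousLinearMap.coe_coe]
  rw [← h1, real_inner_comm, ← h2, real_inner_comm]

/-- ⟨S h, h⟩ = ‖D S h‖², and D S h = 0 would make `h` orthogonal to the dense domain. -/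
theorem inner_solution_operator_pos (hS : ∀ h : H, ∃ W : K, (S h, W) ∈ G ∧
    ∀ q ∈ G, inner ℝ W q.2 = inner ℝ h q.1) (hdense : ∀ h : H, (∀ q ∈ G, inner ℝ h q.1 = 0) → h = 0)
    {h : H} (hh : h ≠ 0) : 0 < inner ℝ (S h) h := by
  obtain ⟨W, hW, hWq⟩ := hS h
  rw [real_inner_comm, ← hWq _ hW, real_inner_self_eq_norm_sq]
  have : W ≠ 0 := by
    rintro rfl
    exact hh (hdense h fun q hq => by rw [← hWq q hq, inner_zero_left])
  positivity

/-- `S` is a norm limit of the finite-rank operators P_F S: projecting onto F is at least as good as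
the approximant from `hF`, and ‖D S h‖ ≤ C ‖h‖. -/
theorem isCompactOperator_solution_operator [CompleteSpace H] {C : ℝ} (hC0 : 0 ≤ C)
    (hC : ∀ p ∈ G, ‖p.1‖ ≤ C * ‖p.2‖)
    (hF : ∀ ε > 0, ∃ F : Submodule ℝ H, FiniteDimensional ℝ F ∧
      ∀ p ∈ G, ∃ g ∈ F, ‖p.1 - g‖ ≤ ε * ‖p.2‖)
    (hS : ∀ h : H, ∃ W : K, (S h, W) ∈ G ∧ ∀ q ∈ G, inner ℝ W q.2 = inner ℝ h q.1) :
    IsCompactOperator S := by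
  have hcl := isClosed_setOfPred_isCompactOperator (σ₁₂ := RingHom.id ℝ) (M₁ := H) (M₂ := H)
  refine hcl.closure_subset (Metric.mem_closure_iff.2 fun ε hε => ?_ : S ∈ closure _)
  obtain ⟨F, hFd, hFa⟩ := hF (ε / (2 * (C + 1))) (by positivity)
  refine ⟨F.starProjection.comp S, ?_, ?_⟩
  · have : ProperSpace F := FiniteDimensional.proper ℝ F
    have h1 : IsCompactOperator (F.orthogonalProjectionOnto.comp S) :=
      isCompactOperator_of_locallyCompactSpace_dom _
    exact h1.clm_comp F.subtypeL
  · rw [dist_eq_norm]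
    refine (ContinuousLinearMap.opNorm_le_bound _ (M := ε / 2) (by positivity) fun h => ?_).trans_lt
      (by linarith)
    obtain ⟨W, hW, hWq⟩ := hS h
    obtain ⟨g, hg, hgle⟩ := hFa _ hW
    have h1 : ‖S h - F.starProjection (S h)‖ ≤ ‖S h - g‖ := by
      rw [Submodule.starProjection_minimal]
      exact ciInf_le ⟨0, by rintro _ ⟨x, rfl⟩; positivity⟩ (⟨g, hg⟩ : F)
    have h2 : ‖W‖ ≤ C * ‖h‖ := by
      have h3 : ‖W‖ ^ 2 ≤ ‖h‖ * (C * ‖W‖) := by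
        rw [← real_inner_self_eq_norm_sq, hWq _ hW]
        exact (real_inner_le_norm _ _).trans (by gcongr; exact hC _ hW)
      by_contra! hlt
      have hWpos : 0 < ‖W‖ := lt_of_le_of_lt (by positivity) hlt
      nlinarith
    calc ‖(S - F.starProjection.comp S) h‖ = ‖S h - F.starProjection (S h)‖ := rfl
      _ ≤ ε / (2 * (C + 1)) * ‖W‖ := h1.trans hgle
      _ ≤ ε / (2 * (C + 1)) * ((C + 1) * ‖h‖) := by
          gcongr
          exact h2.trans (by gcongr; linarith)
      _ = ε / 2 * ‖h‖ := by field_simp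

end Abstract

/-! ### The Gagliardo form as a closed operator -/

variable {N : ℕ} {s : ℝ} {Ω : Set (RN N)}

/-- The weighted difference `(u(x) - u(y)) / |x - y|^((N + 2s)/2)`. -/
noncomputable def diffQuot (s : ℝ) (u : RN N → ℝ) (z : RN N × RN N) : ℝ :=
  (u z.1 - u z.2) / ‖z.1 - z.2‖ ^ (((N : ℝ) + 2 * s) / 2)

/-- Splitting the weight evenly turns the bracket into an L² inner product. -/
theorem kernelFun_eq_mul (u v : RN N → ℝ) (z : RN N × RN N) :
    kernelFun s u v z = diffQuot s u z * diffQuot s v z := by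
  have h : ‖z.1 - z.2‖ ^ ((N : ℝ) + 2 * s) = (‖z.1 - z.2‖ ^ (((N : ℝ) + 2 * s) / 2)) ^ 2 := by
    rw [← Real.rpow_mul_natCast (norm_nonneg _)]
    congr 1
    push_cast
    ring
  rw [kernelFun, diffQuot, diffQuot, h, div_mul_div_comm, sq]

theorem ae_fst_snd {p : RN N → Prop} (h : ∀ᵐ x, p x) :
    ∀ᵐ z : RN N × RN N, p z.1 ∧ p z.2 :=
  (Measure.quasiMeasurePreserving_fst.ae h).and (Measure.quasiMeasurePreserving_snd.ae h)

theorem diffQuot_congr {u v : RN N → ℝ} (h : u =ᵐ[volume] v) :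
    diffQuot s u =ᵐ[volume] diffQuot s v := by
  filter_upwards [ae_fst_snd h] with z hz
  rw [diffQuot, diffQuot, hz.1, hz.2]

theorem kernelFun_congr {u u' v v' : RN N → ℝ} (h : u =ᵐ[volume] u') (h' : v =ᵐ[volume] v') :
    kernelFun s u v =ᵐ[volume] kernelFun s u' v' := by
  filter_upwards [diffQuot_congr (s := s) h, diffQuot_congr (s := s) h'] with z hz hz'
  rw [kernelFun_eq_mul, kernelFun_eq_mul, hz, hz']

theorem aestronglyMeasurable_diffQuot {u : RN N → ℝ} (h : AEStronglyMeasurable u volume) :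
    AEStronglyMeasurable (diffQuot s u) (volume : Measure (RN N × RN N)) := by
  have h1 : AEStronglyMeasurable (fun z : RN N × RN N => u z.1) volume :=
    h.comp_quasiMeasurePreserving Measure.quasiMeasurePreserving_fst
  have h2 : AEStronglyMeasurable (fun z : RN N × RN N => u z.2) volume :=
    h.comp_quasiMeasurePreserving Measure.quasiMeasurePreserving_snd
  have h3 : Measurable fun z : RN N × RN N => ‖z.1 - z.2‖ ^ (((N : ℝ) + 2 * s) / 2) := by
    fun_prop
  exact ((h1.sub h2).aemeasurable.div h3.aemeasurable).aestronglyMeasurable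

theorem integrable_kernelFun_iff {u : RN N → ℝ} (h : AEStronglyMeasurable u volume) :
    Integrable (kernelFun s u u) volume ↔ MemLp (diffQuot s u) 2 volume := by
  rw [memLp_two_iff_integrable_sq (aestronglyMeasurable_diffQuot h)]
  refine integrable_congr (ae_of_all _ fun z => ?_)
  rw [kernelFun_eq_mul]
  exact (sq _).symm

theorem diffQuot_add (u v : RN N → ℝ) : diffQuot s (u + v) = diffQuot s u + diffQuot s v := by
  funext z; simp only [diffQuot, Pi.add_apply]; ring

theorem diffQuot_smul (c : ℝ) (u : RN N → ℝ) : diffQuot s (c • u) = c • diffQuot s u := by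
  funext z; simp only [diffQuot, Pi.smul_apply, smul_eq_mul]; ring

theorem pairing_congr {u u' v v' : RN N → ℝ} (h : u =ᵐ[volume] u') (h' : v =ᵐ[volume] v') :
    pairing s u v = pairing s u' v' :=
  integral_congr_ae (kernelFun_congr h h')

theorem MemX0.congr {u v : RN N → ℝ} (hu : MemX0 s Ω u) (h : u =ᵐ[volume] v) :
    MemX0 s Ω v where
  memLp := hu.memLp.ae_eq h
  ae_eq_zero := by
    filter_upwards [hu.ae_eq_zero, h] with x hx hx' hxΩ
    rw [← hx', hx hxΩ]
  integrable := hu.integrable.congr (kernelFun_congr h h)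

theorem indicator_ae_eq {f g : RN N → ℝ} (hΩ : MeasurableSet Ω) (h : f =ᵐ[volOn Ω] g) :
    Ω.indicator f =ᵐ[volume] Ω.indicator g := by
  filter_upwards [(ae_restrict_iff' hΩ).1 h] with x hx
  by_cases hxΩ : x ∈ Ω
  · simp [hxΩ, hx hxΩ]
  · simp [hxΩ]

theorem MemX0.indicator_ae_eq {u : RN N → ℝ} (hu : MemX0 s Ω u) :
    Ω.indicator u =ᵐ[volume] u := by
  filter_upwards [hu.ae_eq_zero] with x hx
  by_cases hxΩ : x ∈ Ω
  · simp [hxΩ]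
  · simp [hxΩ, hx hxΩ]

theorem setIntegral_mul_eq_inner (u v : Lp ℝ 2 (volOn Ω)) :
    ∫ x in Ω, u x * v x = inner ℝ u v := by
  rw [L2.inner_def]
  refine integral_congr_ae (ae_of_all _ fun x => ?_)
  simp [mul_comm]

theorem memLp_indicator (hΩ : MeasurableSet Ω) (u : Lp ℝ 2 (volOn Ω)) :
    MemLp (Ω.indicator u) 2 volume :=
  (memLp_indicator_iff_restrict hΩ).2 (Lp.memLp u)

/-- The graph of `u ↦ (u(x) - u(y)) / |x - y|^((N + 2s)/2)` as an unbounded operator from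
`L²(Ω)` to `L²(ℝ^N × ℝ^N)`; its domain is `X_0^s(Ω)`. -/
noncomputable def diffGraph (s : ℝ) {Ω : Set (RN N)} (hΩ : MeasurableSet Ω) :
    Submodule ℝ (Lp ℝ 2 (volOn Ω) × Lp ℝ 2 (volume : Measure (RN N × RN N))) where
  carrier := {p | p.2 =ᵐ[volume] diffQuot s (Ω.indicator p.1)}
  zero_mem' := by
    have h : Ω.indicator ((0 : Lp ℝ 2 (volOn Ω)) : RN N → ℝ) =ᵐ[volume] Ω.indicator 0 :=
      indicator_ae_eq hΩ (Lp.coeFn_zero _ _ _)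
    have h' := Lp.coeFn_zero ℝ 2 (volume : Measure (RN N × RN N))
    filter_upwards [diffQuot_congr (s := s) h, h'] with z hz hz'
    rw [Prod.fst_zero, Prod.snd_zero, hz, hz']
    simp [diffQuot]
  add_mem' := by
    rintro ⟨u, U⟩ ⟨v, V⟩ hu hv
    simp only [Set.mem_ofPred_eq] at hu hv ⊢
    have h := indicator_ae_eq hΩ (Lp.coeFn_add u v)
    rw [Set.indicator_add'] at h
    filter_upwards [diffQuot_congr (s := s) h, Lp.coeFn_add U V, hu, hv] with z h1 h2 h3 h4
    rw [Prod.mk_add_mk, h1, h2, diffQuot_add, Pi.add_apply, Pi.add_apply, h3, h4]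
  smul_mem' := by
    rintro c ⟨u, U⟩ hu
    simp only [Set.mem_ofPred_eq] at hu ⊢
    have h := indicator_ae_eq hΩ (Lp.coeFn_smul c u)
    have h' : Ω.indicator (c • (u : RN N → ℝ)) = c • Ω.indicator (u : RN N → ℝ) := by
      funext x
      by_cases hx : x ∈ Ω <;> simp [hx]
    rw [h'] at h
    filter_upwards [diffQuot_congr (s := s) h, Lp.coeFn_smul c U, hu] with z h1 h2 h3
    rw [Prod.smul_mk, h1, h2, diffQuot_smul, Pi.smul_apply, Pi.smul_apply, h3]

theorem mem_diffGraph {hΩ : MeasurableSet Ω}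
    {p : Lp ℝ 2 (volOn Ω) × Lp ℝ 2 (volume : Measure (RN N × RN N))} :
    p ∈ diffGraph s hΩ ↔ p.2 =ᵐ[volume] diffQuot s (Ω.indicator p.1) := Iff.rfl

theorem memX0_of_mem_diffGraph {hΩ : MeasurableSet Ω}
    {p : Lp ℝ 2 (volOn Ω) × Lp ℝ 2 (volume : Measure (RN N × RN N))}
    (hp : p ∈ diffGraph s hΩ) : MemX0 s Ω (Ω.indicator p.1) where
  memLp := memLp_indicator hΩ p.1
  ae_eq_zero := ae_of_all _ fun _ hx => Set.indicator_of_notMem hx _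
  integrable := (integrable_kernelFun_iff (memLp_indicator hΩ p.1).1).2
    ((Lp.memLp p.2).ae_eq hp)

theorem MemX0.exists_mem_diffGraph (hΩ : MeasurableSet Ω) {u : RN N → ℝ} (hu : MemX0 s Ω u) :
    ∃ p ∈ diffGraph s hΩ, p.1 =ᵐ[volOn Ω] u ∧ Ω.indicator p.1 =ᵐ[volume] u := by
  have h1 : MemLp u 2 (volOn Ω) := hu.memLp.restrict Ω
  have h2 := (integrable_kernelFun_iff hu.memLp.1).1 hu.integrable
  have h3 : Ω.indicator (h1.toLp u) =ᵐ[volume] u :=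
    (FracLap.indicator_ae_eq hΩ h1.coeFn_toLp).trans hu.indicator_ae_eq
  exact ⟨⟨h1.toLp u, h2.toLp _⟩, h2.coeFn_toLp.trans (diffQuot_congr h3.symm), h1.coeFn_toLp, h3⟩

theorem pairing_eq_inner {hΩ : MeasurableSet Ω}
    {p q : Lp ℝ 2 (volOn Ω) × Lp ℝ 2 (volume : Measure (RN N × RN N))}
    (hp : p ∈ diffGraph s hΩ) (hq : q ∈ diffGraph s hΩ) :
    pairing s (Ω.indicator p.1) (Ω.indicator q.1) = inner ℝ p.2 q.2 := by
  rw [L2.inner_def]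
  refine integral_congr_ae ?_
  filter_upwards [mem_diffGraph.1 hp, mem_diffGraph.1 hq] with z h1 h2
  rw [kernelFun_eq_mul, h1, h2]
  simp [mul_comm]

/-- The graph relation is pointwise, and L² convergence yields a.e. convergence along a subsequence,
extracted successively for the two components. -/
theorem isClosed_diffGraph (hΩ : MeasurableSet Ω) :
    IsClosed (diffGraph s hΩ : Set (Lp ℝ 2 (volOn Ω) ×
      Lp ℝ 2 (volume : Measure (RN N × RN N)))) := by
  refine IsSeqClosed.isClosed fun p q hp hlim => ?_
  have hl1 : Tendsto (fun n => (p n).1) atTop (𝓝 q.1) := (continuous_fst.tendsto q).comp hlim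
  have hl2 : Tendsto (fun n => (p n).2) atTop (𝓝 q.2) := (continuous_snd.tendsto q).comp hlim
  obtain ⟨n1, hn1, h1⟩ := (tendstoInMeasure_of_tendsto_Lp hl1).exists_seq_tendsto_ae
  obtain ⟨n2, hn2, h2⟩ := (tendstoInMeasure_of_tendsto_Lp
    (hl2.comp hn1.tendsto_atTop)).exists_seq_tendsto_ae
  have h1' := (ae_restrict_iff' hΩ).1 h1
  have hind : ∀ᵐ x : RN N, Tendsto (fun k => Ω.indicator (p (n1 (n2 k))).1 x) atTop
      (𝓝 (Ω.indicator q.1 x)) := by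
    filter_upwards [h1'] with x hx
    by_cases hxΩ : x ∈ Ω
    · simp only [Set.indicator_of_mem hxΩ]
      exact (hx hxΩ).comp hn2.tendsto_atTop
    · simp [hxΩ]
  have hall : ∀ᵐ z : RN N × RN N, ∀ k,
      (p (n1 (n2 k))).2 z = diffQuot s (Ω.indicator (p (n1 (n2 k))).1) z :=
    ae_all_iff.2 fun k => hp _
  refine mem_diffGraph.2 ?_
  filter_upwards [ae_fst_snd hind, h2, hall] with z hz1 hz2 hz3
  refine tendsto_nhds_unique hz2 ?_
  simp only [Function.comp_apply, hz3]
  exact (hz1.1.sub hz1.2).div_const _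

/-! ### Fractional Poincaré inequality -/

theorem ofReal_norm_sq_eq_lintegral {α : Type*} [MeasurableSpace α] {μ : Measure α}
    (u : Lp ℝ 2 μ) : ENNReal.ofReal (‖u‖ ^ 2) = ∫⁻ x, ENNReal.ofReal (u x ^ 2) ∂μ := by
  rw [← ofReal_integral_eq_lintegral_ofReal (Lp.memLp u).integrable_sq
    (ae_of_all _ fun x => sq_nonneg _), ← real_inner_self_eq_norm_sq, L2.inner_def]
  congr 1
  refine integral_congr_ae (ae_of_all _ fun x => ?_)
  simp [sq]

theorem sq_sub_le_mul_sq_diffQuot (ha : 0 ≤ (N : ℝ) + 2 * s) (u : RN N → ℝ) {z : RN N × RN N}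
    {D : ℝ} (hD : ‖z.1 - z.2‖ ≤ D) :
    (u z.1 - u z.2) ^ 2 ≤ D ^ ((N : ℝ) + 2 * s) * diffQuot s u z ^ 2 := by
  have h0 : 0 ≤ D := (norm_nonneg _).trans hD
  rcases eq_or_ne z.1 z.2 with h | h
  · rw [h, sub_self, zero_pow two_ne_zero]
    positivity
  have hpos : 0 < ‖z.1 - z.2‖ := norm_pos_iff.2 (sub_ne_zero.2 h)
  have h1 : (u z.1 - u z.2) ^ 2 = ‖z.1 - z.2‖ ^ ((N : ℝ) + 2 * s) * diffQuot s u z ^ 2 := by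
    have h2 := kernelFun_eq_mul (s := s) u u z
    rw [← sq] at h2
    rw [← h2, kernelFun]
    field_simp
  rw [h1]
  gcongr

/-- The fractional Poincaré inequality on a bounded set. -/
theorem exists_norm_le_mul_norm_of_mem_diffGraph (hN : 0 < N) (hs : 0 < s)
    (hΩ : MeasurableSet Ω) (hΩb : Bornology.IsBounded Ω) :
    ∃ C : ℝ, 0 ≤ C ∧ ∀ p ∈ diffGraph s hΩ, ‖p.1‖ ≤ C * ‖p.2‖ := by
  have : NeZero N := ⟨hN.ne'⟩
  obtain ⟨R, hR, hΩR⟩ := hΩb.subset_ball_lt 0 0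
  -- The unit ball about `x₀` misses Ω and lies within 2R + 2 of each of its points. For y in that
  -- ball u(y) = 0, so |u(x)|² is bounded by `M` times the squared quotient; then integrate over Ω ×
  -- B.
  obtain ⟨x₀, hx₀⟩ := exists_norm_eq (RN N) (c := R + 1) (by linarith)
  set B := Metric.ball x₀ 1 with hB
  set M : ℝ := (2 * R + 2) ^ ((N : ℝ) + 2 * s) with hM
  have hM0 : 0 ≤ M := by positivity
  have hBpos : 0 < volume.real B :=
    ENNReal.toReal_pos (Metric.measure_ball_pos _ _ one_pos).ne' measure_ball_lt_top.ne
  refine ⟨Real.sqrt (M / volume.real B), Real.sqrt_nonneg _, fun p hp => ?_⟩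
  have hprod : (volume : Measure (RN N × RN N)).restrict (Ω ×ˢ B) =
      (volume.restrict Ω).prod (volume.restrict B) := by
    rw [Measure.volume_eq_prod, Measure.prod_restrict]
  have key : ENNReal.ofReal (‖p.1‖ ^ 2) * volume B ≤ ENNReal.ofReal M *
      ENNReal.ofReal (‖p.2‖ ^ 2) := by
    calc ENNReal.ofReal (‖p.1‖ ^ 2) * volume B
        = (∫⁻ x in Ω, ENNReal.ofReal (p.1 x ^ 2)) * ∫⁻ x in B, 1 := by
          rw [ofReal_norm_sq_eq_lintegral, setLIntegral_one]
      _ = ∫⁻ z in Ω ×ˢ B, ENNReal.ofReal (p.1 z.1 ^ 2) := by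
          rw [← lintegral_prod_mul (by fun_prop) (by fun_prop), hprod]
          simp only [mul_one]
      _ ≤ ∫⁻ z in Ω ×ˢ B, ENNReal.ofReal M *
            ENNReal.ofReal (diffQuot s (Ω.indicator p.1) z ^ 2) := by
          refine setLIntegral_mono' (hΩ.prod measurableSet_ball) fun z hz => ?_
          have h1 : ‖z.1‖ < R := by simpa using hΩR hz.1
          have h2 : ‖z.2 - x₀‖ < 1 := by simpa [B, dist_eq_norm] using hz.2
          have h3 : ‖z.1 - z.2‖ ≤ 2 * R + 2 := by
            calc ‖z.1 - z.2‖ = ‖z.1 - (z.2 - x₀) - x₀‖ := by congr 1; abel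
              _ ≤ ‖z.1‖ + ‖z.2 - x₀‖ + ‖x₀‖ :=
                (norm_sub_le _ _).trans (add_le_add_left (norm_sub_le _ _) _)
              _ ≤ _ := by linarith
          have h4 : z.2 ∉ Ω := by
            intro h
            have h5 : ‖z.2‖ < R := by simpa using hΩR h
            have h6 := norm_sub_norm_le x₀ z.2
            rw [norm_sub_rev] at h6
            linarith
          have h7 := sq_sub_le_mul_sq_diffQuot (s := s) (by positivity) (Ω.indicator p.1) h3
          rw [Set.indicator_of_mem hz.1, Set.indicator_of_notMem h4, sub_zero] at h7
          rw [← ENNReal.ofReal_mul hM0]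
          exact ENNReal.ofReal_le_ofReal h7
      _ ≤ ∫⁻ z, ENNReal.ofReal M * ENNReal.ofReal (diffQuot s (Ω.indicator p.1) z ^ 2) :=
          setLIntegral_le_lintegral _ _
      _ = ENNReal.ofReal M * ENNReal.ofReal (‖p.2‖ ^ 2) := by
          rw [lintegral_const_mul' _ _ ENNReal.ofReal_ne_top, ofReal_norm_sq_eq_lintegral]
          congr 1
          refine lintegral_congr_ae ?_
          filter_upwards [mem_diffGraph.1 hp] with z hz
          rw [hz]
  have h1 : ‖p.1‖ ^ 2 * volume.real B ≤ M * ‖p.2‖ ^ 2 := by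
    have h2 := ENNReal.toReal_mono (by finiteness) key
    rwa [ENNReal.toReal_mul, ENNReal.toReal_mul, ENNReal.toReal_ofReal (by positivity),
      ENNReal.toReal_ofReal (by positivity), ENNReal.toReal_ofReal (by positivity)] at h2
  refine abs_le_of_sq_le_sq' ?_ (by positivity) |>.2
  rw [mul_pow, Real.sq_sqrt (by positivity), div_mul_eq_mul_div, le_div_iff₀ hBpos]
  exact h1

/-! ### Infinite dimension of L²(Ω), and density of X_0^s(Ω) -/

/-- Indicators of infinitely many disjoint nonempty open subsets of Ω are nonzero and orthogonal. -/
theorem not_finiteDimensional_Lp (hN : 0 < N) (hΩo : IsOpen Ω) (hΩb : Bornology.IsBounded Ω)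
    (hΩn : Ω.Nonempty) : ¬ FiniteDimensional ℝ (Lp ℝ 2 (volOn Ω)) := by
  have : NeZero N := ⟨hN.ne'⟩
  intro hfd
  have hinf : Infinite Ω := by
    obtain ⟨x, hx⟩ := hΩn
    exact (infinite_of_mem_nhds x (hΩo.mem_nhds hx)).to_subtype
  obtain ⟨U, hUi, hUo, hUd⟩ := exists_seq_infinite_isOpen_pairwise_disjoint Ω
  let W : ℕ → Set (RN N) := fun n => Subtype.val '' U n
  have hWo : ∀ n, IsOpen (W n) := fun n => hΩo.isOpenMap_subtype_val _ (hUo n)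
  have hWΩ : ∀ n, W n ⊆ Ω := fun n => by rintro _ ⟨x, -, rfl⟩; exact x.2
  have hWvol : ∀ n, volOn Ω (W n) = volume (W n) := fun n =>
    Measure.restrict_eq_self _ (hWΩ n)
  have hWpos : ∀ n, 0 < volOn Ω (W n) := fun n => by
    rw [hWvol]
    exact (hWo n).measure_pos _ ((hUi n).nonempty.image _)
  have hWfin : ∀ n, volOn Ω (W n) ≠ ⊤ := fun n => by
    rw [hWvol]
    exact ((measure_mono (hWΩ n)).trans_lt hΩb.measure_lt_top).ne
  let v : ℕ → Lp ℝ 2 (volOn Ω) := fun n =>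
    indicatorConstLp 2 (hWo n).measurableSet (hWfin n) (1 : ℝ)
  have hv : LinearIndependent ℝ v := by
    refine linearIndependent_of_ne_zero_of_inner_eq_zero (fun n => ?_) fun m n hmn => ?_
    · rw [← norm_ne_zero_iff, norm_indicatorConstLp (by simp) (by simp)]
      have := ENNReal.toReal_pos (hWpos n).ne' (hWfin n)
      simp only [norm_one, one_mul, Measure.real]
      positivity
    · simp only [v]
      rw [L2.inner_indicatorConstLp_eq_inner_setIntegral]
      have h : ∫ x in W m, (v n) x ∂(volOn Ω) = 0 := by
        refine integral_eq_zero_of_ae ?_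
        have h1 := ae_restrict_of_ae (s := W m) (indicatorConstLp_coeFn (p := 2)
          (hs := (hWo n).measurableSet) (hμs := hWfin n) (c := (1 : ℝ)))
        filter_upwards [h1, ae_restrict_mem (hWo m).measurableSet] with x hx hxm
        rw [hx, Set.indicator_of_notMem]
        · rfl
        · rintro ⟨y, hy, hyx⟩
          obtain ⟨y', hy', hyx'⟩ := hxm
          have : y = y' := Subtype.ext (hyx.trans hyx'.symm)
          exact Set.disjoint_left.1 (hUd hmn) hy' (this ▸ hy)
      rw [h, inner_zero_right]
  have := hv.finite
  exact not_finite ℕ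

theorem ae_eq_zero_of_forall_isTestFun (hΩo : IsOpen Ω) {u : RN N → ℝ}
    (hu : Integrable u (volOn Ω)) (h : ∀ g, IsTestFun Ω g → ∫ x in Ω, u x * g x = 0) :
    u =ᵐ[volOn Ω] 0 := by
  rw [EventuallyEq, ae_restrict_iff' hΩo.measurableSet]
  refine hΩo.ae_eq_zero_of_integral_contDiff_smul_eq_zero
    (IntegrableOn.locallyIntegrableOn hu) fun g h1 h2 h3 => ?_
  rw [← h g ⟨h1, h2, h3⟩, ← setIntegral_eq_integral_of_forall_compl_eq_zero (s := Ω)]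
  · simp only [smul_eq_mul, mul_comm]
  · intro x hx
    rw [image_eq_zero_of_notMem_tsupport fun h => hx (h3 h), zero_smul]

/-- In polar coordinates the integrand is at most A r^(1 - 2s) near 0, integrable as s < 1, and B
r^(-1 - 2s) at infinity, integrable as s > 0. -/
theorem integrable_min_sq_div_rpow (hN : 0 < N) (hs0 : 0 < s) (hs1 : s < 1) {A B : ℝ}
    (hA : 0 ≤ A) (hB : 0 ≤ B) :
    Integrable (fun w : RN N => min (A * ‖w‖ ^ 2) B / ‖w‖ ^ ((N : ℝ) + 2 * s)) volume := by
  have : NeZero N := ⟨hN.ne'⟩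
  rw [integrable_fun_norm_addHaar volume
    (f := fun r : ℝ => min (A * r ^ 2) B / r ^ ((N : ℝ) + 2 * s))]
  have hdim : Module.finrank ℝ (RN N) = N := by simp
  rw [hdim, ← Set.Ioo_union_Ici_eq_Ioi one_pos, integrableOn_union]
  have hmeas : Measurable fun r : ℝ =>
      r ^ (N - 1) • (min (A * r ^ 2) B / r ^ ((N : ℝ) + 2 * s)) := by fun_prop
  have hpow : ∀ r : ℝ, 0 < r → r ^ (N - 1) = r ^ ((N : ℝ) - 1) := fun r hr => by
    rw [← Real.rpow_natCast, Nat.cast_pred hN]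
  constructor
  · have h1 : IntegrableOn (fun r : ℝ => A * r ^ (1 - 2 * s)) (Set.Ioo 0 1) :=
      ((intervalIntegral.integrableOn_Ioo_rpow_iff one_pos).2 (by linarith)).const_mul A
    refine h1.mono' hmeas.aestronglyMeasurable ?_
    refine (ae_restrict_iff' measurableSet_Ioo).2 (ae_of_all _ fun r hr => ?_)
    have hr0 : 0 < r := hr.1
    rw [Real.norm_of_nonneg (by positivity), smul_eq_mul, hpow r hr0]
    calc r ^ ((N : ℝ) - 1) * (min (A * r ^ 2) B / r ^ ((N : ℝ) + 2 * s))
        ≤ r ^ ((N : ℝ) - 1) * ((A * r ^ 2) / r ^ ((N : ℝ) + 2 * s)) := by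
          gcongr; exact min_le_left _ _
      _ = A * (r ^ ((N : ℝ) - 1) * r ^ (2 : ℝ) / r ^ ((N : ℝ) + 2 * s)) := by
          rw [Real.rpow_two]; ring
      _ = A * r ^ (1 - 2 * s) := by
          rw [← Real.rpow_add hr0, ← Real.rpow_sub hr0]
          congr 2; ring
  · rw [integrableOn_Ici_iff_integrableOn_Ioi]
    have h1 : IntegrableOn (fun r : ℝ => B * r ^ (-1 - 2 * s)) (Set.Ioi 1) :=
      (integrableOn_Ioi_rpow_of_lt (by linarith) one_pos).const_mul B
    refine h1.mono' hmeas.aestronglyMeasurable ?_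
    refine (ae_restrict_iff' measurableSet_Ioi).2 (ae_of_all _ fun r hr => ?_)
    have hr0 : 0 < r := one_pos.trans hr
    rw [Real.norm_of_nonneg (by positivity), smul_eq_mul, hpow r hr0]
    calc r ^ ((N : ℝ) - 1) * (min (A * r ^ 2) B / r ^ ((N : ℝ) + 2 * s))
        ≤ r ^ ((N : ℝ) - 1) * (B / r ^ ((N : ℝ) + 2 * s)) := by
          gcongr; exact min_le_right _ _
      _ = B * (r ^ ((N : ℝ) - 1) / r ^ ((N : ℝ) + 2 * s)) := by ring
      _ = B * r ^ (-1 - 2 * s) := by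
          rw [← Real.rpow_sub hr0]
          congr 2; ring

/-- The kernel vanishes unless one of the points lies in the support. The Lipschitz and sup bounds
of `g` then dominate it by χ(y) φ(x - y) + χ(x) φ(y - x), a sum of convolution integrands of
integrable functions. -/
theorem IsTestFun.memX0 (hN : 0 < N) (hs0 : 0 < s) (hs1 : s < 1) {g : RN N → ℝ}
    (hg : IsTestFun Ω g) : MemX0 s Ω g := by
  obtain ⟨hg1, hg2, hg3⟩ := hg
  have hcont := hg1.continuous
  have hmem : MemLp g 2 volume := hcont.memLp_of_hasCompactSupport hg2
  refine ⟨hmem, ae_of_all _ fun x hx => image_eq_zero_of_notMem_tsupport fun h => hx (hg3 h), ?_⟩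
  obtain ⟨L, hL⟩ := hg1.lipschitzWith_of_hasCompactSupport hg2 (by simp)
  obtain ⟨M, hM⟩ := hg2.exists_bound_of_continuous hcont
  set φ : RN N → ℝ := fun w =>
    min ((L : ℝ) ^ 2 * ‖w‖ ^ 2) ((2 * M) ^ 2) / ‖w‖ ^ ((N : ℝ) + 2 * s) with hφ
  have hφ0 : ∀ w, 0 ≤ φ w := fun w => by positivity
  have hφi : Integrable φ volume :=
    integrable_min_sq_div_rpow hN hs0 hs1 (by positivity) (by positivity)
  set χ : RN N → ℝ := (tsupport g).indicator 1 with hχ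
  have hχi : Integrable χ volume :=
    (integrable_indicator_iff (isClosed_tsupport g).measurableSet).2
      (integrableOn_const (C := (1 : ℝ)) hg2.isCompact.measure_lt_top.ne)
  have hχ0 : ∀ x, 0 ≤ χ x := fun x => Set.indicator_nonneg (fun _ _ => zero_le_one) x
  have hconv : Integrable (fun z : RN N × RN N => χ z.2 * φ (z.1 - z.2)) volume :=
    hχi.convolution_integrand (ContinuousLinearMap.mul ℝ ℝ) hφi
  have hdom : Integrable (fun z : RN N × RN N =>
      χ z.2 * φ (z.1 - z.2) + χ z.1 * φ (z.2 - z.1)) volume := hconv.add hconv.swap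
  have hker : AEStronglyMeasurable (kernelFun s g g) volume := by
    have h := aestronglyMeasurable_diffQuot (s := s) hmem.1
    refine (h.mul h).congr (ae_of_all _ fun z => ?_)
    rw [kernelFun_eq_mul]; rfl
  refine hdom.mono' hker (ae_of_all _ fun z => ?_)
  have hφs : φ (z.2 - z.1) = φ (z.1 - z.2) := by simp only [hφ, norm_sub_rev]
  rw [hφs, ← add_mul, kernelFun, ← sq, Real.norm_of_nonneg (by positivity)]
  by_cases h0 : z.1 ∉ tsupport g ∧ z.2 ∉ tsupport g
  · rw [image_eq_zero_of_notMem_tsupport h0.1, image_eq_zero_of_notMem_tsupport h0.2]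
    simp only [sub_self, ne_eq, OfNat.ofNat_ne_zero, not_false_eq_true, zero_pow, zero_div]
    exact mul_nonneg (add_nonneg (hχ0 _) (hχ0 _)) (hφ0 _)
  · have hone : 1 ≤ χ z.2 + χ z.1 := by
      by_cases h1 : z.1 ∈ tsupport g
      · have : χ z.1 = 1 := by simp [hχ, h1]
        linarith [hχ0 z.2]
      · have h2 : z.2 ∈ tsupport g := by
          by_contra h2; exact h0 ⟨h1, h2⟩
        have : χ z.2 = 1 := by simp [hχ, h2]
        linarith [hχ0 z.1]
    have hle : (g z.1 - g z.2) ^ 2 / ‖z.1 - z.2‖ ^ ((N : ℝ) + 2 * s) ≤ φ (z.1 - z.2) := by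
      simp only [hφ]
      gcongr
      refine le_min ?_ ?_
      · rw [← mul_pow, ← sq_abs]
        have := hL.dist_le_mul z.1 z.2
        rw [Real.dist_eq, dist_eq_norm] at this
        gcongr
      · rw [← sq_abs]
        have h1 := hM z.1
        have h2 := hM z.2
        rw [Real.norm_eq_abs] at h1 h2
        have h3 := abs_sub (g z.1) (g z.2)
        gcongr
        linarith
    exact hle.trans (le_mul_of_one_le_left (hφ0 _) hone)

theorem eq_zero_of_forall_mem_diffGraph_inner_eq_zero (hN : 0 < N) (hs0 : 0 < s) (hs1 : s < 1)
    (hΩo : IsOpen Ω) (hΩb : Bornology.IsBounded Ω) {h : Lp ℝ 2 (volOn Ω)}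
    (hh : ∀ q ∈ diffGraph s hΩo.measurableSet, inner ℝ h q.1 = 0) : h = 0 := by
  have : IsFiniteMeasure (volOn Ω) := ⟨by simpa using hΩb.measure_lt_top⟩
  rw [Lp.eq_zero_iff_ae_eq_zero]
  refine ae_eq_zero_of_forall_isTestFun hΩo ((Lp.memLp h).integrable one_le_two) fun g hg => ?_
  obtain ⟨q, hq, hq1, -⟩ :=
    (hg.memX0 hN hs0 hs1).exists_mem_diffGraph hΩo.measurableSet
  rw [← hh q hq, ← setIntegral_mul_eq_inner]
  refine integral_congr_ae ?_
  filter_upwards [hq1] with x hx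
  rw [hx]

/-! ### Compactness by step functions on cubes -/

/-- The index of the half-open cube of side `h` that contains `x`. -/
noncomputable def cubeIndex (h : ℝ) (x : RN N) : Fin N → ℤ := fun i => ⌊x i / h⌋

theorem measurable_cubeIndex (h : ℝ) : Measurable (cubeIndex (N := N) h) := by
  unfold cubeIndex
  fun_prop

theorem measurableSet_cube (h : ℝ) (k : Fin N → ℤ) :
    MeasurableSet (cubeIndex (N := N) h ⁻¹' {k}) :=
  measurable_cubeIndex h (measurableSet_singleton k)

theorem volume_cube {h : ℝ} (hh : 0 < h) (k : Fin N → ℤ) :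
    volume (cubeIndex (N := N) h ⁻¹' {k}) = ENNReal.ofReal (h ^ N) := by
  have h1 : cubeIndex (N := N) h ⁻¹' {k} = WithLp.ofLp ⁻¹'
      (Set.univ.pi fun i => Set.Ico ((k i : ℝ) * h) (((k i : ℝ) + 1) * h)) := by
    ext x
    simp only [Set.mem_preimage, Set.mem_singleton_iff, Set.mem_pi, Set.mem_univ, true_imp_iff,
      Set.mem_Ico, funext_iff, cubeIndex, Int.floor_eq_iff, le_div_iff₀ hh, div_lt_iff₀ hh]
  rw [h1, (PiLp.volume_preserving_ofLp (Fin N)).measure_preimage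
      (MeasurableSet.univ_pi fun i => measurableSet_Ico).nullMeasurableSet,
    volume_pi_pi]
  simp only [Real.volume_Ico]
  rw [Finset.prod_congr rfl fun i _ => by rw [show ((k i : ℝ) + 1) * h - k i * h = h by ring]]
  simp [ENNReal.ofReal_pow hh.le]

theorem norm_sub_le_of_cubeIndex_eq {h : ℝ} (hh : 0 < h) {x y : RN N}
    (hxy : cubeIndex h x = cubeIndex h y) : ‖x - y‖ ≤ Real.sqrt N * h := by
  have h1 : ∀ i, ‖(x - y) i‖ ^ 2 ≤ h ^ 2 := fun i => by
    have h2 := Int.abs_sub_lt_one_of_floor_eq_floor (congrFun hxy i)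
    rw [← sub_div, abs_div, abs_of_pos hh, div_lt_one hh] at h2
    rw [Real.norm_eq_abs, PiLp.sub_apply]
    gcongr
  rw [EuclideanSpace.norm_eq]
  calc Real.sqrt (∑ i, ‖(x - y) i‖ ^ 2) ≤ Real.sqrt (N * h ^ 2) := by
        refine Real.sqrt_le_sqrt ((Finset.sum_le_sum fun i _ => h1 i).trans ?_)
        simp
    _ = Real.sqrt N * h := by
        rw [Real.sqrt_mul (by positivity), Real.sqrt_sq hh.le]

theorem exists_finset_cubeIndex_mem (hΩb : Bornology.IsBounded Ω) {h : ℝ} (hh : 0 < h) :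
    ∃ T : Finset (Fin N → ℤ), ∀ x ∈ Ω, cubeIndex h x ∈ T := by
  obtain ⟨R, hR⟩ := hΩb.exists_norm_le
  refine ⟨Finset.Icc (fun _ => ⌊-R / h⌋) (fun _ => ⌊R / h⌋), fun x hx => ?_⟩
  rw [Finset.mem_Icc]
  have h1 : ∀ i, |x i| ≤ R := fun i => by
    rw [← Real.norm_eq_abs]
    exact (PiLp.norm_apply_le x i).trans (hR x hx)
  constructor <;> intro i <;> refine Int.floor_le_floor ?_ <;> gcongr
  · exact (abs_le.1 (h1 i)).1
  · exact (abs_le.1 (h1 i)).2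

/-- On a cube, a function is close to one of its values, in terms of the Gagliardo seminorm. -/
theorem exists_lintegral_cube_sq_sub_le (ha : 0 ≤ (N : ℝ) + 2 * s) {h : ℝ} (hh : 0 < h)
    {u : RN N → ℝ} (hu : Measurable u) (k : Fin N → ℤ) :
    ∃ c : ℝ, ∫⁻ x in cubeIndex h ⁻¹' {k}, ENNReal.ofReal ((u x - c) ^ 2) ≤
      ENNReal.ofReal ((Real.sqrt N * h) ^ ((N : ℝ) + 2 * s) / h ^ N) *
        ∫⁻ z in (cubeIndex h ⁻¹' {k}) ×ˢ (cubeIndex h ⁻¹' {k}),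
          ENNReal.ofReal (diffQuot s u z ^ 2) := by
  set Q := cubeIndex (N := N) h ⁻¹' {k} with hQ
  have hQm : MeasurableSet Q := measurableSet_cube h k
  have hQv : volume Q = ENNReal.ofReal (h ^ N) := volume_cube hh k
  have hhN : 0 < h ^ N := by positivity
  have hprod : (volume : Measure (RN N × RN N)).restrict (Q ×ˢ Q) =
      (volume.restrict Q).prod (volume.restrict Q) := by
    rw [Measure.volume_eq_prod, Measure.prod_restrict]
  have hm : Measurable fun z : RN N × RN N => ENNReal.ofReal ((u z.1 - u z.2) ^ 2) := by
    fun_prop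
  -- Some y in the cube makes ∫ |u(x) - u(y)|² dx at most its mean over y; u(y) serves as the
  -- constant.
  obtain ⟨y, -, hy⟩ := exists_le_setLAverage (μ := volume) (s := Q)
    (f := fun y => ∫⁻ x in Q, ENNReal.ofReal ((u x - u y) ^ 2))
    (by rw [hQv]; simpa using hhN) (by rw [hQv]; exact ENNReal.ofReal_ne_top)
    (hm.lintegral_prod_left' (μ := volume.restrict Q)).aemeasurable
  refine ⟨u y, hy.trans ?_⟩
  rw [setLAverage_eq, hQv, lintegral_lintegral_symm (f := fun y x => ENNReal.ofReal ((u x - u y) ^ 2))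
    (hm.comp measurable_swap).aemeasurable,
    div_eq_mul_inv, ← ENNReal.ofReal_inv_of_pos hhN, mul_comm, div_eq_inv_mul,
    ENNReal.ofReal_mul (by positivity), mul_assoc]
  gcongr
  rw [← lintegral_const_mul' _ _ ENNReal.ofReal_ne_top, ← hprod]
  refine setLIntegral_mono' (hQm.prod hQm) fun z hz => ?_
  rw [← ENNReal.ofReal_mul (by positivity)]
  exact ENNReal.ofReal_le_ofReal (sq_sub_le_mul_sq_diffQuot ha u
    (norm_sub_le_of_cubeIndex_eq hh (Eq.trans hz.1 (Eq.symm hz.2))))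

/-- `X_0^s(Ω)` is approximated in `L²(Ω)` by finite-dimensional spaces, uniformly on sets bounded
in the Gagliardo seminorm. -/
theorem exists_finiteDimensional_norm_sub_le (hs : 0 < s) (hΩ : MeasurableSet Ω)
    (hΩb : Bornology.IsBounded Ω) {ε : ℝ} (hε : 0 < ε) :
    ∃ F : Submodule ℝ (Lp ℝ 2 (volOn Ω)), FiniteDimensional ℝ F ∧
      ∀ p ∈ diffGraph s hΩ, ∃ g ∈ F, ‖p.1 - g‖ ≤ ε * ‖p.2‖ := by
  have ha : 0 ≤ (N : ℝ) + 2 * s := by positivity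
  have : IsFiniteMeasure (volOn Ω) := ⟨by simpa using hΩb.measure_lt_top⟩
  -- The factor from a single cube is A h^(2s), so h solves h^(2s) = ε² / (A + 1).
  obtain ⟨h, hh, hhε⟩ : ∃ h : ℝ, 0 < h ∧
      (Real.sqrt N * h) ^ ((N : ℝ) + 2 * s) / h ^ N ≤ ε ^ 2 := by
    set A : ℝ := Real.sqrt N ^ ((N : ℝ) + 2 * s) with hA
    have hA0 : 0 ≤ A := by positivity
    set h : ℝ := (ε ^ 2 / (A + 1)) ^ (1 / (2 * s)) with hdef
    have hh : 0 < h := by positivity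
    refine ⟨h, hh, ?_⟩
    have h1 : h ^ (2 * s) = ε ^ 2 / (A + 1) := by
      rw [hdef, ← Real.rpow_mul (by positivity), one_div_mul_cancel (by positivity),
        Real.rpow_one]
    rw [Real.mul_rpow (by positivity) hh.le, Real.rpow_add hh, Real.rpow_natCast, h1, ← hA]
    calc A * (h ^ N * (ε ^ 2 / (A + 1))) / h ^ N = A / (A + 1) * ε ^ 2 := by
          field_simp
      _ ≤ 1 * ε ^ 2 := by
          gcongr
          rw [div_le_one (by positivity)]
          linarith
      _ = ε ^ 2 := one_mul _
  obtain ⟨T, hT⟩ := exists_finset_cubeIndex_mem hΩb hh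
  have hmem : ∀ c : T → ℝ, MemLp (fun x => ∑ k, c k *
      (cubeIndex (N := N) h ⁻¹' {(k : Fin N → ℤ)}).indicator 1 x) 2 (volOn Ω) := fun c =>
    memLp_finsetSum _ fun k _ =>
      (((memLp_const (1 : ℝ)).indicator (measurableSet_cube h _)).const_mul (c k))
  let Φ : (T → ℝ) →ₗ[ℝ] Lp ℝ 2 (volOn Ω) :=
    { toFun := fun c => (hmem c).toLp _
      map_add' := fun c d => by
        rw [← MemLp.toLp_add]
        refine MemLp.toLp_congr _ _ (ae_of_all _ fun x => ?_)
        simp only [Pi.add_apply, add_mul, Finset.sum_add_distrib]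
      map_smul' := fun a c => by
        rw [RingHom.id_apply, ← MemLp.toLp_const_smul]
        refine MemLp.toLp_congr _ _ (ae_of_all _ fun x => ?_)
        simp only [Pi.smul_apply, smul_eq_mul, Finset.mul_sum, mul_assoc] }
  refine ⟨LinearMap.range Φ, inferInstance, fun p hp => ?_⟩
  have hum : Measurable (Ω.indicator p.1) := (Lp.stronglyMeasurable p.1).measurable.indicator hΩ
  choose c hc using fun k => exists_lintegral_cube_sq_sub_le ha hh hum k
  refine ⟨Φ fun k => c k, LinearMap.mem_range_self _ _, ?_⟩
  have hΦ : ∀ᵐ x ∂(volOn Ω), (Φ fun k => c k) x = c (cubeIndex h x) := by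
    filter_upwards [(hmem fun k => c k).coeFn_toLp, ae_restrict_mem hΩ] with x hx hxΩ
    refine hx.trans ?_
    rw [Finset.sum_eq_single ⟨cubeIndex h x, hT x hxΩ⟩]
    · simp
    · intro k _ hk
      rw [Set.indicator_of_notMem, mul_zero]
      exact fun hk' => hk (Subtype.ext hk'.symm)
    · exact fun hk => absurd (Finset.mem_univ _) hk
  -- The squares Q × Q are disjoint in ℝ^N × ℝ^N, so the bounds on single cubes add up to the full
  -- seminorm. Cubes crossing the boundary are harmless because `u` is extended by zero.
  have key : ENNReal.ofReal (‖p.1 - Φ fun k => c k‖ ^ 2) ≤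
      ENNReal.ofReal ((ε * ‖p.2‖) ^ 2) := by
    set Q : (Fin N → ℤ) → Set (RN N) := fun k => cubeIndex (N := N) h ⁻¹' {k} with hQ
    have hQm : ∀ k, MeasurableSet (Q k) := measurableSet_cube h
    have hQd : Pairwise (Function.onFun Disjoint Q) := fun k l hkl =>
      Disjoint.preimage _ (Set.disjoint_singleton.2 hkl)
    calc ENNReal.ofReal (‖p.1 - Φ fun k => c k‖ ^ 2)
        = ∫⁻ x in Ω, ENNReal.ofReal ((Ω.indicator p.1 x - c (cubeIndex h x)) ^ 2) := by
          rw [ofReal_norm_sq_eq_lintegral]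
          refine lintegral_congr_ae ?_
          filter_upwards [Lp.coeFn_sub p.1 (Φ fun k => c k), hΦ, ae_restrict_mem hΩ]
            with x h1 h2 h3
          rw [h1, Pi.sub_apply, h2, Set.indicator_of_mem h3]
      _ ≤ ∫⁻ x in ⋃ k ∈ T, Q k,
            ENNReal.ofReal ((Ω.indicator p.1 x - c (cubeIndex h x)) ^ 2) :=
          lintegral_mono_set fun x hx => Set.mem_biUnion (hT x hx) rfl
      _ = ∑ k ∈ T, ∫⁻ x in Q k,
            ENNReal.ofReal ((Ω.indicator p.1 x - c (cubeIndex h x)) ^ 2) :=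
          lintegral_biUnion_finset (fun k _ l _ hkl => hQd hkl) (fun k _ => hQm k) _
      _ = ∑ k ∈ T, ∫⁻ x in Q k, ENNReal.ofReal ((Ω.indicator p.1 x - c k) ^ 2) := by
          refine Finset.sum_congr rfl fun k _ => setLIntegral_congr_fun (hQm k) fun x hx => ?_
          have hx' : cubeIndex h x = k := hx
          simp only [hx']
      _ ≤ ∑ k ∈ T, ENNReal.ofReal (ε ^ 2) *
            ∫⁻ z in Q k ×ˢ Q k, ENNReal.ofReal (diffQuot s (Ω.indicator p.1) z ^ 2) := by
          refine Finset.sum_le_sum fun k _ => (hc k).trans ?_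
          gcongr
      _ = ENNReal.ofReal (ε ^ 2) * ∫⁻ z in ⋃ k ∈ T, Q k ×ˢ Q k,
            ENNReal.ofReal (diffQuot s (Ω.indicator p.1) z ^ 2) := by
          rw [← Finset.mul_sum, lintegral_biUnion_finset
            (fun k _ l _ hkl => Set.disjoint_prod.2 (Or.inl (hQd hkl)))
            (fun k _ => (hQm k).prod (hQm k))]
      _ ≤ ENNReal.ofReal (ε ^ 2) *
            ∫⁻ z, ENNReal.ofReal (diffQuot s (Ω.indicator p.1) z ^ 2) := by
          gcongr
          exact Measure.restrict_le_self
      _ = ENNReal.ofReal ((ε * ‖p.2‖) ^ 2) := by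
          rw [mul_pow, ENNReal.ofReal_mul (by positivity), ofReal_norm_sq_eq_lintegral p.2]
          congr 1
          refine lintegral_congr_ae ?_
          filter_upwards [mem_diffGraph.1 hp] with z hz
          rw [hz]
  rw [ENNReal.ofReal_le_ofReal_iff (by positivity)] at key
  exact (abs_le_of_sq_le_sq' key (by positivity)).2

/-! ### Solution operator and L¹-weak solutions -/

theorem HasFracLap.congr_right {u f f' : RN N → ℝ}
    (h : HasFracLap s Ω u f) (hf : f =ᵐ[volOn Ω] f') : HasFracLap s Ω u f' := by
  refine ⟨h.1, fun v hv => (h.2 v hv).trans (integral_congr_ae ?_)⟩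
  filter_upwards [hf] with x hx
  rw [hx]

theorem HasFracLap.congr_left {u u' f : RN N → ℝ}
    (h : HasFracLap s Ω u f) (hu : u =ᵐ[volume] u') : HasFracLap s Ω u' f :=
  ⟨h.1.congr hu, fun v hv => (pairing_congr hu.symm ae_eq_rfl).trans (h.2 v hv)⟩

/-- Translates the weak equation into the graph form used by the abstract solution operator. -/
theorem hasFracLap_indicator_iff (hΩ : MeasurableSet Ω) {u f : Lp ℝ 2 (volOn Ω)} :
    HasFracLap s Ω (Ω.indicator u) f ↔ ∃ W, (u, W) ∈ diffGraph s hΩ ∧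
      ∀ q ∈ diffGraph s hΩ, inner ℝ W q.2 = inner ℝ f q.1 := by
  constructor
  · rintro ⟨h1, h2⟩
    obtain ⟨⟨u', W⟩, hp, hpu, -⟩ := h1.exists_mem_diffGraph hΩ
    have hu : u' = u := Lp.ext (hpu.trans (indicator_ae_eq_restrict hΩ))
    subst hu
    refine ⟨W, hp, fun q hq => ?_⟩
    rw [← pairing_eq_inner hp hq, h2 _ (memX0_of_mem_diffGraph hq), ← setIntegral_mul_eq_inner]
    refine setIntegral_congr_fun hΩ fun x hx => ?_
    simp only [Set.indicator_of_mem hx]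
  · rintro ⟨W, hW, hWq⟩
    refine ⟨memX0_of_mem_diffGraph hW, fun v hv => ?_⟩
    obtain ⟨q, hq, hq1, hq2⟩ := hv.exists_mem_diffGraph hΩ
    rw [← pairing_congr ae_eq_rfl hq2, pairing_eq_inner hW hq, hWq q hq,
      ← setIntegral_mul_eq_inner]
    refine integral_congr_ae ?_
    filter_upwards [hq1] with x hx
    rw [hx]

/-- Both sides equal ⟨Du, Dv⟩. -/
theorem HasFracLap.inner_comm (hΩ : MeasurableSet Ω) {u f v g : Lp ℝ 2 (volOn Ω)}
    (hu : HasFracLap s Ω (Ω.indicator u) f) (hv : HasFracLap s Ω (Ω.indicator v) g) :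
    inner ℝ f v = inner ℝ g u := by
  obtain ⟨W, hW, hWq⟩ := (hasFracLap_indicator_iff hΩ).1 hu
  obtain ⟨Z, hZ, hZq⟩ := (hasFracLap_indicator_iff hΩ).1 hv
  rw [← hWq _ hZ, ← hZq _ hW, real_inner_comm]

/-- The solution operator of the Dirichlet problem for `(-Δ)^s` on `L²(Ω)`. -/
theorem exists_fracLap_solution_operator (hN : 0 < N) (hs0 : 0 < s) (hs1 : s < 1)
    (hΩo : IsOpen Ω) (hΩb : Bornology.IsBounded Ω) :
    ∃ S : Lp ℝ 2 (volOn Ω) →L[ℝ] Lp ℝ 2 (volOn Ω),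
      (∀ f : Lp ℝ 2 (volOn Ω), HasFracLap s Ω (Ω.indicator (S f)) f) ∧
      IsCompactOperator S ∧ (S : Lp ℝ 2 (volOn Ω) →ₗ[ℝ] Lp ℝ 2 (volOn Ω)).IsSymmetric ∧
      ∀ f, f ≠ 0 → 0 < inner ℝ (S f) f := by
  have hΩ := hΩo.measurableSet
  obtain ⟨C, hC0, hC⟩ := exists_norm_le_mul_norm_of_mem_diffGraph hN hs0 hΩ hΩb
  obtain ⟨S, hS⟩ := exists_solution_operator (isClosed_diffGraph hΩ) hC
  exact ⟨S, fun f => (hasFracLap_indicator_iff hΩ).2 (hS f),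
    isCompactOperator_solution_operator hC0 hC
      (fun ε hε => exists_finiteDimensional_norm_sub_le hs0 hΩ hΩb hε) hS,
    isSymmetric_solution_operator hS,
    fun f hf => inner_solution_operator_pos hS (fun h hh =>
      eq_zero_of_forall_mem_diffGraph_inner_eq_zero hN hs0 hs1 hΩo hΩb hh) hf⟩

section SolutionOperator

variable {S : Lp ℝ 2 (volOn Ω) →L[ℝ] Lp ℝ 2 (volOn Ω)}

theorem HasFracLap.eq_solution (hΩ : MeasurableSet Ω)
    (hS : ∀ f : Lp ℝ 2 (volOn Ω), HasFracLap s Ω (Ω.indicator (S f)) f)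
    {u f : Lp ℝ 2 (volOn Ω)} (hu : HasFracLap s Ω (Ω.indicator u) f) : u = S f :=
  ext_inner_left ℝ fun g =>
    (hu.inner_comm hΩ (hS g)).symm.trans ((hS f).inner_comm hΩ (hS g))

theorem IsTestFun.memLp_two {g : RN N → ℝ} (hg : IsTestFun Ω g) : MemLp g 2 (volOn Ω) :=
  (hg.1.continuous.memLp_of_hasCompactSupport hg.2.1).restrict Ω

/-- By symmetry of the bracket, ∫ f ψ = ∫ (S f) g whenever (-Δ)^s ψ = g, so the weak equation says ∫
u g = ∫ (S f) g. Every g ∈ C_c^∞(Ω) occurs, with ψ = S g, and these determine an L¹ function. -/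
theorem l1WeakEq_iff_eq_solution (hΩo : IsOpen Ω) (hΩb : Bornology.IsBounded Ω)
    (hS : ∀ f : Lp ℝ 2 (volOn Ω), HasFracLap s Ω (Ω.indicator (S f)) f)
    {u : RN N →ₘ[volOn Ω] ℝ} (hu : u ∈ Lp ℝ 1 (volOn Ω)) (f : Lp ℝ 2 (volOn Ω)) :
    L1WeakEq s Ω u (f : RN N →ₘ[volOn Ω] ℝ) ↔ u = (S f : RN N →ₘ[volOn Ω] ℝ) := by
  have hΩ := hΩo.measurableSet
  have : IsFiniteMeasure (volOn Ω) := ⟨by simpa using hΩb.measure_lt_top⟩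
  have hSint : Integrable (S f) (volOn Ω) := (Lp.memLp (S f)).integrable one_le_two
  constructor
  · intro h
    have huint : Integrable u (volOn Ω) := memLp_one_iff_integrable.1 (Lp.memLp ⟨u, hu⟩)
    refine AEEqFun.ext ?_
    have h0 : (fun x => u x - S f x) =ᵐ[volOn Ω] 0 := by
      refine ae_eq_zero_of_forall_isTestFun hΩo (huint.sub hSint) fun g hg => ?_
      have hg' := hg.memLp_two
      -- Boundedness of `g` is what makes u g integrable when `u` is only in L¹.
      obtain ⟨M, hM⟩ := hg.2.1.exists_bound_of_continuous hg.1.continuous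
      have hgm : AEStronglyMeasurable g (volOn Ω) := hg'.1
      have h1 := h _ g hg ((hS (hg'.toLp g)).congr_right hg'.coeFn_toLp)
      have h2 : ∫ x in Ω, f x * Ω.indicator (S (hg'.toLp g)) x = inner ℝ f (S (hg'.toLp g)) := by
        rw [← setIntegral_mul_eq_inner]
        refine setIntegral_congr_fun hΩ fun x hx => ?_
        simp only [Set.indicator_of_mem hx]
      have h3 : ∫ x in Ω, S f x * g x = inner ℝ (S f) (hg'.toLp g) := by
        rw [← setIntegral_mul_eq_inner]
        refine integral_congr_ae ?_
        filter_upwards [hg'.coeFn_toLp] with x hx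
        rw [hx]
      have h4 : ∫ x in Ω, (u x - S f x) * g x = (∫ x in Ω, u x * g x) - ∫ x in Ω, S f x * g x := by
        rw [← integral_sub (huint.mul_bdd hgm (ae_of_all _ hM))
          (hSint.mul_bdd hgm (ae_of_all _ hM))]
        simp only [sub_mul]
      rw [h4, h1, h3, sub_eq_zero, real_inner_comm, ← (hS f).inner_comm hΩ (hS (hg'.toLp g)), ← h2]
    filter_upwards [h0] with x hx
    exact sub_eq_zero.1 hx
  · rintro rfl ψ g hg hψ
    have hg' := hg.memLp_two
    obtain ⟨p, -, hp1, hp2⟩ := hψ.1.exists_mem_diffGraph hΩ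
    have h1 : HasFracLap s Ω (Ω.indicator p.1) (hg'.toLp g) :=
      (hψ.congr_left hp2.symm).congr_right hg'.coeFn_toLp.symm
    have h2 : ∫ x in Ω, S f x * g x = inner ℝ (S f) (hg'.toLp g) := by
      rw [← setIntegral_mul_eq_inner]
      refine integral_congr_ae ?_
      filter_upwards [hg'.coeFn_toLp] with x hx
      rw [hx]
    have h3 : ∫ x in Ω, f x * ψ x = inner ℝ f p.1 := by
      rw [← setIntegral_mul_eq_inner]
      refine integral_congr_ae ?_
      filter_upwards [hp1] with x hx
      rw [hx]
    exact h2.trans ((real_inner_comm _ _).trans (((hS f).inner_comm hΩ h1).symm.trans h3.symm))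

end SolutionOperator

/-! ### Eigenbases and the space E^{2s} -/

section Eigenbasis

variable {lam : ℕ → ℝ} {φ : HilbertBasis ℕ ℝ (Lp ℝ 2 (volOn Ω))}
  {S : Lp ℝ 2 (volOn Ω) →L[ℝ] Lp ℝ 2 (volOn Ω)}

theorem isEigenbasis_iff : IsEigenbasis s Ω lam φ ↔
    ∀ j, HasFracLap s Ω (Ω.indicator (φ j)) (lam j • φ j : Lp ℝ 2 (volOn Ω)) := by
  have h : ∀ j, ((lam j • φ j : Lp ℝ 2 (volOn Ω)) : RN N → ℝ) =ᵐ[volOn Ω]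
      fun x => lam j * φ j x := fun j => Lp.coeFn_smul _ _
  exact ⟨fun H j => (H j).congr_right (h j).symm, fun H j => (H j).congr_right (h j)⟩

/-- Symmetry of the bracket between φ_j and S f. -/
theorem lam_mul_repr_solution (hΩ : MeasurableSet Ω)
    (hS : ∀ f : Lp ℝ 2 (volOn Ω), HasFracLap s Ω (Ω.indicator (S f)) f)
    (hφ : IsEigenbasis s Ω lam φ) (f : Lp ℝ 2 (volOn Ω)) (j : ℕ) :
    lam j * φ.repr (S f) j = φ.repr f j := by
  have h := (isEigenbasis_iff.1 hφ j).inner_comm hΩ (hS f)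
  rw [inner_smul_left, real_inner_comm (φ j) f] at h
  rw [HilbertBasis.repr_apply_apply, HilbertBasis.repr_apply_apply]
  exact h

/-- Taking f = φ_j gives λ_j ⟨S φ_j, φ_j⟩ = 1. -/
theorem eigenvalue_pos (hΩ : MeasurableSet Ω)
    (hS : ∀ f : Lp ℝ 2 (volOn Ω), HasFracLap s Ω (Ω.indicator (S f)) f)
    (hpos : ∀ f, f ≠ 0 → 0 < inner ℝ (S f) f)
    (hφ : IsEigenbasis s Ω lam φ) (j : ℕ) : 0 < lam j := by
  have h := lam_mul_repr_solution hΩ hS hφ (φ j) j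
  rw [HilbertBasis.repr_apply_apply, HilbertBasis.repr_apply_apply, real_inner_self_eq_norm_sq,
    φ.orthonormal.1, real_inner_comm] at h
  refine pos_of_mul_pos_left ?_ (hpos _ (φ.orthonormal.ne_zero j)).le
  rw [h]
  norm_num

theorem mem_ESpace_iff (hs0 : 0 < s) (hΩ : MeasurableSet Ω)
    (hS : ∀ f : Lp ℝ 2 (volOn Ω), HasFracLap s Ω (Ω.indicator (S f)) f)
    (hpos : ∀ f, f ≠ 0 → 0 < inner ℝ (S f) f)
    (hφ : IsEigenbasis s Ω lam φ) {u : RN N →ₘ[volOn Ω] ℝ} :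
    u ∈ ESpace s (2 * s) lam φ ↔ ∃ f : Lp ℝ 2 (volOn Ω), u = (S f : RN N →ₘ[volOn Ω] ℝ) := by
  have h2 : 2 * s / s = 2 := by field_simp
  have hterm : ∀ (v : Lp ℝ 2 (volOn Ω)) (j : ℕ),
      lam j ^ (2 * s / s) * (φ.repr v j) ^ 2 = (lam j * φ.repr v j) ^ 2 := fun v j => by
    rw [h2, Real.rpow_two, mul_pow]
  constructor
  · rintro ⟨hu, hsum⟩
    simp only [hterm] at hsum
    have hmem : Memℓp (fun j => lam j * φ.repr ⟨u, hu⟩ j) 2 := by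
      refine memℓp_gen ?_
      simpa [mul_pow] using hsum
    -- The preimage of `u` under `S` has coefficients λ_j a_j.
    refine ⟨φ.repr.symm ⟨_, hmem⟩, ?_⟩
    have h : (⟨u, hu⟩ : Lp ℝ 2 (volOn Ω)) = S (φ.repr.symm ⟨_, hmem⟩) := by
      apply φ.repr.injective
      ext j
      have h1 := lam_mul_repr_solution hΩ hS hφ (φ.repr.symm ⟨_, hmem⟩) j
      rw [LinearIsometryEquiv.apply_symm_apply] at h1
      exact (mul_left_cancel₀ (eigenvalue_pos hΩ hS hpos hφ j).ne' h1).symm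
    exact congrArg Subtype.val h
  · rintro ⟨f, rfl⟩
    refine ⟨(S f).2, ?_⟩
    simp only [hterm, Subtype.coe_eta, lam_mul_repr_solution hΩ hS hφ]
    have h := (lp.memℓp (φ.repr f)).summable (by simp)
    simpa using h

theorem hasSum_powerTerm (hs0 : 0 < s) (hΩ : MeasurableSet Ω)
    (hS : ∀ f : Lp ℝ 2 (volOn Ω), HasFracLap s Ω (Ω.indicator (S f)) f)
    (hφ : IsEigenbasis s Ω lam φ) (f : Lp ℝ 2 (volOn Ω)) :
    HasSum (powerTerm s (2 * s) lam φ (S f)) f := by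
  have h : powerTerm s (2 * s) lam φ (S f) = fun j => φ.repr f j • φ j := by
    funext j
    rw [powerTerm, div_self (by positivity), Real.rpow_one, lam_mul_repr_solution hΩ hS hφ]
  rw [h]
  exact φ.hasSum_repr f

theorem exists_isEigenbasis_monotone (hN : 0 < N) (hs0 : 0 < s) (hs1 : s < 1)
    (hΩo : IsOpen Ω) (hΩb : Bornology.IsBounded Ω) (hΩn : Ω.Nonempty) :
    ∃ (lam : ℕ → ℝ) (φ : HilbertBasis ℕ ℝ (Lp ℝ 2 (volOn Ω))),
      IsEigenbasis s Ω lam φ ∧ Monotone lam := by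
  obtain ⟨S, hS, hcomp, hsym, hpos⟩ := exists_fracLap_solution_operator hN hs0 hs1 hΩo hΩb
  obtain ⟨φ, μ, hanti, hμ, heig⟩ := exists_hilbertBasis_antitone_eigenvalues
    (not_finiteDimensional_Lp hN hΩo hΩb hΩn) hcomp hsym hpos
  refine ⟨fun j => (μ j)⁻¹, φ, isEigenbasis_iff.2 fun j => ?_,
    fun i j hij => inv_anti₀ (hμ j) (hanti hij)⟩
  -- This datum is chosen so that `S` maps it to φ_j itself.
  have h := hS ((μ j)⁻¹ • φ j)
  rwa [map_smul, heig, inv_smul_smul₀ (hμ j).ne'] at h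

end Eigenbasis

end FracLap

/-! ### The main theorem -/

theorem mainTheorem6 (N : ℕ) (s : ℝ) (hs0 : 0 < s) (hs1 : s < 1) (hN : 2 * s < N)
    (Ω : Set (FracLap.RN N)) (hΩo : IsOpen Ω) (hΩb : Bornology.IsBounded Ω)
    (hΩn : Ω.Nonempty) :
    (∃ (lam : ℕ → ℝ) (φ : HilbertBasis ℕ ℝ (Lp ℝ 2 (FracLap.volOn Ω))),
      FracLap.IsEigenbasis s Ω lam φ ∧ Monotone lam) ∧
    ∀ (lam : ℕ → ℝ) (φ : HilbertBasis ℕ ℝ (Lp ℝ 2 (FracLap.volOn Ω))),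
      FracLap.IsEigenbasis s Ω lam φ →
        FracLap.ESpace s (2 * s) lam φ = FracLap.HSpace s Ω ∧
        ∀ u : Lp ℝ 2 (FracLap.volOn Ω),
          (u : FracLap.RN N →ₘ[FracLap.volOn Ω] ℝ) ∈ FracLap.ESpace s (2 * s) lam φ →
            Summable (FracLap.powerTerm s (2 * s) lam φ u) ∧
            ∀ f : Lp ℝ 2 (FracLap.volOn Ω),
              FracLap.L1WeakEq s Ω (u : FracLap.RN N →ₘ[FracLap.volOn Ω] ℝ)
                (f : FracLap.RN N →ₘ[FracLap.volOn Ω] ℝ) ↔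
                f = FracLap.APower s (2 * s) lam φ u := by
  have hN0 : 0 < N := by
    have : (0 : ℝ) < N := by linarith
    exact_mod_cast this
  have hΩ := hΩo.measurableSet
  have : IsFiniteMeasure (FracLap.volOn Ω) := ⟨by simpa using hΩb.measure_lt_top⟩
  have hLp : ∀ v : Lp ℝ 2 (FracLap.volOn Ω),
      (v : FracLap.RN N →ₘ[FracLap.volOn Ω] ℝ) ∈ Lp ℝ 1 (FracLap.volOn Ω) := fun v =>
    Lp.antitone one_le_two v.2
  refine ⟨FracLap.exists_isEigenbasis_monotone hN0 hs0 hs1 hΩo hΩb hΩn, fun lam φ hφ => ?_⟩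
  obtain ⟨S, hS, -, -, hpos⟩ := FracLap.exists_fracLap_solution_operator hN0 hs0 hs1 hΩo hΩb
  refine ⟨?_, fun u hu => ?_⟩
  · ext u
    rw [FracLap.mem_ESpace_iff hs0 hΩ hS hpos hφ]
    constructor
    · rintro ⟨f, rfl⟩
      exact ⟨hLp _, f, f.2, (FracLap.l1WeakEq_iff_eq_solution hΩo hΩb hS (hLp _) f).2 rfl⟩
    · rintro ⟨hu, f, hf, hw⟩
      exact ⟨⟨f, hf⟩, (FracLap.l1WeakEq_iff_eq_solution hΩo hΩb hS hu ⟨f, hf⟩).1 hw⟩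
  · obtain ⟨f₀, hf₀⟩ := (FracLap.mem_ESpace_iff hs0 hΩ hS hpos hφ).1 hu
    have hu₀ : u = S f₀ := Subtype.ext hf₀
    have hsum := FracLap.hasSum_powerTerm hs0 hΩ hS hφ f₀
    rw [hu₀]
    refine ⟨hsum.summable, fun f => ?_⟩
    rw [FracLap.l1WeakEq_iff_eq_solution hΩo hΩb hS (hLp _) f, FracLap.APower, hsum.tsum_eq]
    constructor
    · intro h
      -- Uniqueness of the datum: positivity makes `S` injective.
      have h1 : S (f - f₀) = 0 := by rw [map_sub, ← Subtype.ext h, sub_self]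
      by_contra hne
      have h2 := hpos _ (sub_ne_zero.2 hne)
      rw [h1, inner_zero_left] at h2
      exact h2.false
    · rintro rfl
      rfl
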